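/- Let $AP$ be a finite set of atomic propositions. A timed word over $2^{AP}$ is an infinite sequence $\rho=(\sigma_1,\tau_1)(\sigma_2,\tau_2)\cdots$ with $\sigma_i\subseteq AP$ and $0\le\tau_1\le\tau_2\le\cdots$ real numbers that are unbounded. The formulae of Extended Metric Interval Temporal Logic ($\mathsf{EMITL}$) over $AP$ are generated by $$\phi ::= \top \mid p \mid \phi_1\wedge\phi_2 \mid \neg\phi \mid \mathcal A_I(\phi_1,\dots,\phi_n),$$ where $p\in AP$, $\mathcal A$ is a non-deterministic finite automaton over the alphabet $\{1,\dots,n\}$, and $I\subseteq\mathbb R_{\ge 0}$ is a non-singular (and nonempty) interval with endpoints in $\mathbb N\cup\{\infty\}$. Satisfaction $(\rho,i)\models\phi$ at a position $i\ge 1$ is defined as usual for $\top,p,\wedge,\neg$ (with $(\rho,i)\models p$ iff $p\in\sigma_i$), and $(\rho,i)\models\mathcal A_I(\phi_1,\dots,\phi_n)$ iff there are $j\ge i$ with $\tau_j-\tau_i\in I$ and a word $a_i\cdots a_j$ over $\{1,\dots,n\}$ accepted by $\mathcal A$ such that $(\rho,\ell)\models\phi_{a_\ell}$ for every $i\le\ell\le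 j$. The timed language of $\phi$ is $[\![\phi]\!]=\{\rho : (\rho,1)\models\phi\}$. Let $\mathsf{EMITL}_{0,\infty}$ be the fragment of formulae in which every constraining interval $I$ is an upper bound ($[0,b]$ or $[0,b)$) or a lower bound ($[a,\infty)$ or $(a,\infty)$). Then $\mathsf{EMITL}_{0,\infty}$ and $\mathsf{EMITL}$ are equally expressive over timed words: a set of timed words over $2^{AP}$ is the timed language of some $\mathsf{EMITL}_{0,\infty}$ formula over $AP$ if and only if it is the timed language of some $\mathsf{EMITL}$ formula over $AP$. -/

import Mathlib

open scoped NNReal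

namespace EMITL

universe u

/-- A timed word over `Γ`: an infinite sequence of events `(symbol i, time i)` with non-decreasing,
non-Zeno time stamps. Positions are numbered from `0`, so that position `i` here is the
`(i + 1)`-st event. -/
structure TimedWord (Γ : Type u) where
  symbol : ℕ → Γ
  time : ℕ → ℝ≥0
  time_mono : Monotone time
  nonZeno : ∀ r : ℝ≥0, ∃ j, r ≤ time j

/-- A timed language is a set of timed words. -/
abbrev TimedLanguage (Γ : Type u) := Set (TimedWord Γ)

/-- Non-singular intervals of non-negative reals whose endpoints are natural numbers or `∞`. -/
inductive Interval : Type
  | Icc (a b : ℕ) (h : a < b)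
  | Ico (a b : ℕ) (h : a < b)
  | Ioc (a b : ℕ) (h : a < b)
  | Ioo (a b : ℕ) (h : a < b)
  | Ici (a : ℕ)
  | Ioi (a : ℕ)

namespace Interval

/-- The set of real numbers denoted by an interval. -/
def toSet : Interval → Set ℝ
  | Icc a b _ => Set.Icc (a : ℝ) (b : ℝ)
  | Ico a b _ => Set.Ico (a : ℝ) (b : ℝ)
  | Ioc a b _ => Set.Ioc (a : ℝ) (b : ℝ)
  | Ioo a b _ => Set.Ioo (a : ℝ) (b : ℝ)
  | Ici a => Set.Ici (a : ℝ)
  | Ioi a => Set.Ioi (a : ℝ)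

/-- The interval is an upper bound (`≤ b` or `< b`, that is, `[0, b]` or `[0, b)`) or a lower bound
(`≥ a` or `> a`, that is, `[a, ∞)` or `(a, ∞)`). -/
def IsOneSided : Interval → Prop
  | Icc a _ _ => a = 0
  | Ico a _ _ => a = 0
  | Ioc _ _ _ => False
  | Ioo _ _ _ => False
  | Ici _ => True
  | Ioi _ => True

end Interval

/-- A non-deterministic finite automaton over the `n`-ary alphabet, with one initial location. -/
structure Automaton (n : ℕ) : Type 1 where
  Loc : Type
  finite_loc : Finite Loc
  init : Loc
  trans : Set (Loc × Fin n × Loc)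
  final : Set Loc

/-- The same automaton as a Mathlib `NFA`, which provides the accepted language. -/
def Automaton.toNFA {n : ℕ} (A : Automaton n) : NFA (Fin n) A.Loc where
  step s a := {s' | (s, a, s') ∈ A.trans}
  start := {A.init}
  accept := A.final

/-- Formulae of Extended Metric Interval Temporal Logic over the atomic propositions `AP`. -/
inductive Formula (AP : Type u) : Type (max u 1)
  | top : Formula AP
  | atom (p : AP) : Formula AP
  | and (φ ψ : Formula AP) : Formula AP
  | neg (φ : Formula AP) : Formula AP
  | modality (n : ℕ) (A : Automaton n) (I : Interval) (args : Fin n → Formula AP) : Formula AP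

namespace Formula

variable {AP : Type u}

/-- The pointwise semantics: `φ.Sat ρ i` means that `φ` holds in `ρ` at position `i`. In the clause
for automata modalities, `w` is the nonempty word read at the positions `i, …, j`. -/
def Sat : Formula AP → TimedWord (Set AP) → ℕ → Prop
  | top, _, _ => True
  | atom p, ρ, i => p ∈ ρ.symbol i
  | and φ ψ, ρ, i => φ.Sat ρ i ∧ ψ.Sat ρ i
  | neg φ, ρ, i => ¬ φ.Sat ρ i
  | modality n A I args, ρ, i =>
      ∃ j, i ≤ j ∧ (ρ.time j : ℝ) - (ρ.time i : ℝ) ∈ I.toSet ∧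
        ∃ w : List (Fin n), i + w.length = j + 1 ∧ w ∈ A.toNFA.accepts ∧
          ∀ (l : ℕ) (hl : l < w.length), (args w[l]).Sat ρ (i + l)

/-- The timed language of a formula: the timed words that satisfy it at the first position. -/
def language (φ : Formula AP) : TimedLanguage (Set AP) :=
  {ρ | φ.Sat ρ 0}

/-- Membership in the fragment in which all constraining intervals, at every nesting depth, are
lower or upper bounds. -/
def IsOneSided : Formula AP → Prop
  | top => True
  | atom _ => True
  | and φ ψ => φ.IsOneSided ∧ ψ.IsOneSided
  | neg φ => φ.IsOneSided
  | modality n _ I args => I.IsOneSided ∧ ∀ a : Fin n, (args a).IsOneSided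

end Formula

end EMITL

/-! By induction on formulae, it suffices to express a modality with two-sided interval `J ∩ K` (`J`
a lower, `K` an upper bound). After determinization, marks are the positions where the machine
accepts. A mark in `J` and a mark in `K` may be different marks, so the bounds can be tested
separately only for a uniquely determined position. Isolated marks lie at least one time unit apart,
so a bounded number `r` of them precede `J`. Consider the first mark preceded by exactly `r`
isolated ones. If it is in `J`, it is the first mark there, and only `K` has to be checked. If it
comes before `J`, then the last mark before `J` is not isolated, and its successor within less than
one unit falls into `J`, and into `K` because the interval has length at least one. This is
`exists_mark_iff`. Isolation is a `[0,1)` constraint on the future of a machine state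
(`definable_acceptsSoon`), so a finite machine whose steps consult formulae can count isolated
marks, and `Definable.machine` turns such machines into modalities. -/

namespace EMITL

universe u

variable {AP : Type u}

/-! ### Runs of machines and the subset construction -/

/-- The state of a deterministic machine started in `s₀` at position `i`, after `t` steps. -/
def run {S : Type*} (step : S → ℕ → S) (s₀ : S) (i : ℕ) : ℕ → S
  | 0 => s₀
  | t + 1 => step (run step s₀ i t) (i + t)

/-- The locations reachable from `q` in one step by a letter in `V`. -/
def Automaton.post {n : ℕ} (A : Automaton n) (q : Set A.Loc) (V : Set (Fin n)) : Set A.Loc :=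
  {s' | ∃ s ∈ q, ∃ a ∈ V, (s, a, s') ∈ A.trans}

theorem Automaton.mem_run_post {n : ℕ} (A : Automaton n) (V : ℕ → Set (Fin n)) (i t : ℕ)
    (s : A.Loc) :
    s ∈ run (fun q k => A.post q (V k)) {A.init} i t ↔
      ∃ w : List (Fin n), w.length = t ∧ (∀ (l : ℕ) (hl : l < w.length), w[l] ∈ V (i + l)) ∧
        s ∈ A.toNFA.eval w := by
  induction t generalizing s with
  | zero =>
    constructor
    · intro h
      exact ⟨[], rfl, by simp, h⟩
    · rintro ⟨w, hw, -, h⟩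
      rw [List.length_eq_zero_iff] at hw
      subst hw
      exact h
  | succ t ih =>
    constructor
    · rintro ⟨s', hs', a, ha, htr⟩
      obtain ⟨w, rfl, hw, h⟩ := (ih s').1 hs'
      refine ⟨w ++ [a], by simp, ?_, ?_⟩
      · intro l hl
        rcases Nat.lt_or_ge l w.length with h' | h'
        · rw [List.getElem_append_left h']
          exact hw l h'
        · have : l = w.length := by simp at hl; omega
          subst this
          simpa using ha
      · rw [NFA.eval_append_singleton, NFA.mem_stepSet]
        exact ⟨s', h, htr⟩
    · rintro ⟨w, hlen, hw, h⟩
      rcases List.eq_nil_or_concat w with rfl | ⟨w', a, rfl⟩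
      · simp at hlen
      · simp only [List.concat_eq_append] at hlen hw h
        have hlen' : w'.length = t := by simpa using hlen
        rw [NFA.eval_append_singleton, NFA.mem_stepSet] at h
        obtain ⟨s', hs', htr⟩ := h
        refine ⟨s', (ih s').2 ⟨w', hlen', fun l hl => ?_, hs'⟩, a, ?_, htr⟩
        · have := hw l (by simp; omega)
          rwa [List.getElem_append_left hl] at this
        · have := hw t (by simp; omega)
          subst hlen'
          simpa using this

/-- The subset construction makes acceptance at `i + t` a property of one deterministic run; `t + 1`
steps, since position `i + t` is read too. -/
theorem Formula.sat_modality_iff {n : ℕ} (A : Automaton n) (I : Interval)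
    (args : Fin n → Formula AP) (ρ : TimedWord (Set AP)) (i : ℕ) :
    (Formula.modality n A I args).Sat ρ i ↔
      ∃ t, (ρ.time (i + t) : ℝ) - ρ.time i ∈ I.toSet ∧
        ∃ s ∈ A.final,
          s ∈ run (fun q k => A.post q {a | (args a).Sat ρ k}) {A.init} i (t + 1) := by
  simp only [Automaton.mem_run_post A (fun k => {a | (args a).Sat ρ k}), Formula.Sat]
  constructor
  · rintro ⟨j, hij, hI, w, hw, hacc, hsat⟩
    obtain ⟨t, rfl⟩ := Nat.exists_eq_add_of_le hij
    rw [NFA.mem_accepts] at hacc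
    obtain ⟨s, hs, hs'⟩ := hacc
    exact ⟨t, hI, s, hs, w, by omega, hsat, hs'⟩
  · rintro ⟨t, hI, s, hs, w, hlen, hsat, hs'⟩
    refine ⟨i + t, by omega, hI, w, by omega, ?_, hsat⟩
    rw [NFA.mem_accepts]
    exact ⟨s, hs, hs'⟩

/-! ### Predicates definable by one-sided formulae -/

/-- A predicate on positions of timed words is definable if it is the meaning of a formula with
one-sided intervals only. -/
def Definable (P : TimedWord (Set AP) → ℕ → Prop) : Prop :=
  ∃ φ : Formula AP, φ.IsOneSided ∧ ∀ ρ i, φ.Sat ρ i ↔ P ρ i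

namespace Definable

variable {P Q : TimedWord (Set AP) → ℕ → Prop}

theorem congr (h : Definable P) (hPQ : ∀ ρ i, P ρ i ↔ Q ρ i) : Definable Q := by
  obtain ⟨φ, h1, h2⟩ := h
  exact ⟨φ, h1, fun ρ i => (h2 ρ i).trans (hPQ ρ i)⟩

theorem not (h : Definable P) : Definable fun ρ i => ¬ P ρ i := by
  obtain ⟨φ, h1, h2⟩ := h
  exact ⟨.neg φ, h1, fun ρ i => not_congr (h2 ρ i)⟩

theorem and (hP : Definable P) (hQ : Definable Q) : Definable fun ρ i => P ρ i ∧ Q ρ i := by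
  obtain ⟨φ, h1, h2⟩ := hP
  obtain ⟨ψ, h3, h4⟩ := hQ
  exact ⟨.and φ ψ, ⟨h1, h3⟩, fun ρ i => and_congr (h2 ρ i) (h4 ρ i)⟩

theorem or (hP : Definable P) (hQ : Definable Q) : Definable fun ρ i => P ρ i ∨ Q ρ i :=
  (hP.not.and hQ.not).not.congr fun ρ i => by tauto

theorem iff (hP : Definable P) (hQ : Definable Q) : Definable fun ρ i => (P ρ i ↔ Q ρ i) :=
  ((hP.and hQ).or (hP.not.and hQ.not)).congr fun ρ i => by tauto

theorem const (p : Prop) : Definable (AP := AP) fun _ _ => p := by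
  by_cases hp : p
  · exact ⟨.top, trivial, fun ρ i => by simp [Formula.Sat, hp]⟩
  · exact ⟨.neg .top, trivial, fun ρ i => by simp [Formula.Sat, hp]⟩

theorem forall_mem_finset {ι : Type*} (s : Finset ι) {P : ι → TimedWord (Set AP) → ℕ → Prop}
    (h : ∀ x, Definable (P x)) : Definable fun ρ i => ∀ x ∈ s, P x ρ i := by
  classical
  induction s using Finset.induction_on with
  | empty => exact (const True).congr fun ρ i => by simp
  | insert a s _ ih => exact ((h a).and ih).congr fun ρ i => by simp

theorem forall_finite {ι : Type*} [Finite ι] {P : ι → TimedWord (Set AP) → ℕ → Prop}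
    (h : ∀ x, Definable (P x)) : Definable fun ρ i => ∀ x, P x ρ i := by
  have := Fintype.ofFinite ι
  exact (forall_mem_finset Finset.univ h).congr fun ρ i => by simp

theorem exists_finite {ι : Type*} [Finite ι] {P : ι → TimedWord (Set AP) → ℕ → Prop}
    (h : ∀ x, Definable (P x)) : Definable fun ρ i => ∃ x, P x ρ i :=
  (forall_finite fun x => (h x).not).not.congr fun ρ i => by simp

end Definable

/-- A function of positions of timed words is definable if all its fibres are. -/
def DefinableFun {X : Type*} (f : TimedWord (Set AP) → ℕ → X) : Prop :=
  ∀ x, Definable fun ρ i => f ρ i = x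

namespace DefinableFun

theorem const {X : Type*} (x : X) : DefinableFun (AP := AP) fun _ _ => x :=
  fun y => Definable.const (x = y)

theorem bind {X Y : Type*} [Finite X] {f : TimedWord (Set AP) → ℕ → X}
    {g : X → TimedWord (Set AP) → ℕ → Y} (hf : DefinableFun f) (hg : ∀ x, DefinableFun (g x)) :
    DefinableFun fun ρ i => g (f ρ i) ρ i := fun y =>
  (Definable.exists_finite fun x => (hf x).and (hg x y)).congr fun ρ i => by simp

theorem comp {X Y : Type*} [Finite X] {f : TimedWord (Set AP) → ℕ → X} (hf : DefinableFun f)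
    (g : X → Y) : DefinableFun fun ρ i => g (f ρ i) :=
  hf.bind (g := fun x _ _ => g x) fun x => const (g x)

theorem definable {X : Type*} [Finite X] {f : TimedWord (Set AP) → ℕ → X}
    {P : X → TimedWord (Set AP) → ℕ → Prop} (hf : DefinableFun f) (hP : ∀ x, Definable (P x)) :
    Definable fun ρ i => P (f ρ i) ρ i :=
  (Definable.exists_finite fun x => (hf x).and (hP x)).congr fun ρ i => by simp

end DefinableFun

theorem Definable.definableFun {P : TimedWord (Set AP) → ℕ → Prop} (h : Definable P) :
    DefinableFun P := fun p =>
  (h.iff (Definable.const p)).congr fun ρ i => by simp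

/-- The formula saying that a machine with definable transitions and outputs emits its output at a
time in the interval `I`. -/
theorem Definable.machine {S : Type} [Finite S] {step : S → TimedWord (Set AP) → ℕ → S}
    {out : S → TimedWord (Set AP) → ℕ → Prop} (hstep : ∀ s, DefinableFun (step s))
    (hout : ∀ s, Definable (out s)) (s₀ : S) {I : Interval} (hI : I.IsOneSided) :
    Definable fun ρ i => ∃ t, (ρ.time (i + t) : ℝ) - ρ.time i ∈ I.toSet ∧
      out (run (fun s k => step s ρ k) s₀ i t) ρ (i + t) := by
  classical
  -- A letter is the whole one-step behaviour of the machine at a position. Exactly one letter holds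
  -- at each position, so the automaton has a single run.
  obtain ⟨n, ⟨e⟩⟩ := Finite.exists_equiv_fin (S → S × Prop)
  have hletter : ∀ f : S → S × Prop,
      Definable fun ρ k => (fun s => (step s ρ k, out s ρ k)) = f := fun f =>
    (Definable.forall_finite fun s =>
      (hstep s (f s).1).and ((hout s).definableFun (f s).2)).congr fun ρ k => by
        simp only [funext_iff, Prod.ext_iff]
  choose φ hφ hsat using hletter
  -- The second component stores the output just emitted; its initial value is never tested, because
  -- at least one letter is read.
  let A : Automaton n :=
    { Loc := S × Prop
      finite_loc := inferInstance
      init := (s₀, False)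
      trans := {x | x.2.2 = e.symm x.2.1 x.1.1}
      final := {x | x.2} }
  refine ⟨.modality n A I fun a => φ (e.symm a), ⟨hI, fun a => hφ _⟩, fun ρ i => ?_⟩
  rw [Formula.sat_modality_iff]
  have key : ∀ t,
      run (fun q k => A.post q {a | (φ (e.symm a)).Sat ρ k}) {A.init} i (t + 1) =
        {(run (fun s k => step s ρ k) s₀ i (t + 1),
          out (run (fun s k => step s ρ k) s₀ i t) ρ (i + t))} := by
    have hpost : ∀ (x : S × Prop) (k : ℕ), A.post {x} {a | (φ (e.symm a)).Sat ρ k} =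
        {(step x.1 ρ k, out x.1 ρ k)} := by
      intro x k
      ext y
      simp only [Automaton.post, Set.mem_singleton_iff, exists_eq_left, Set.mem_ofPred_eq, hsat, A]
      constructor
      · rintro ⟨a, ha, rfl⟩
        rw [← ha]
      · rintro rfl
        exact ⟨e fun s => (step s ρ k, out s ρ k), by simp, by simp⟩
    intro t
    induction t with
    | zero => exact hpost (s₀, False) (i + 0)
    | succ t ih =>
      rw [run, ih]
      exact hpost _ _
  refine exists_congr fun t => and_congr_right fun _ => ?_
  rw [key]
  simp only [Set.mem_singleton_iff, exists_eq_right]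
  exact Iff.rfl

/-! ### Marks and isolated marks -/

/-- A mark is isolated if no other mark follows it within less than one time unit. -/
def Isolated (d : ℕ → ℝ) (mark : ℕ → Prop) (t : ℕ) : Prop :=
  mark t ∧ ¬ ∃ s, t < s ∧ mark s ∧ d s - d t < 1

section Marks

open Classical in
/-- The position `t` is the first mark that is preceded by exactly `r` positions in `iso`. -/
def IsFirstMark (mark iso : ℕ → Prop) (r t : ℕ) : Prop :=
  mark t ∧ Nat.count iso t = r ∧ ¬ ∃ s, s < t ∧ mark s ∧ Nat.count iso s = r

open Classical in
/-- The position `t` belongs to `iso` and is preceded by exactly `r` positions in `iso`. -/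
def IsNth (iso : ℕ → Prop) (r t : ℕ) : Prop :=
  iso t ∧ Nat.count iso t = r

variable {mark iso : ℕ → Prop} {r t t' : ℕ} {d : ℕ → ℝ}

theorem IsFirstMark.unique (h : IsFirstMark mark iso r t) (h' : IsFirstMark mark iso r t') :
    t = t' := by
  rcases lt_trichotomy t t' with hlt | heq | hlt
  · exact absurd ⟨t, hlt, h.1, h.2.1⟩ h'.2.2
  · exact heq
  · exact absurd ⟨t', hlt, h'.1, h'.2.1⟩ h.2.2

theorem IsNth.unique (h : IsNth iso r t) (h' : IsNth iso r t') : t = t' := by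
  classical
  exact Nat.count_injective h.1 h'.1 (by convert h.2.trans h'.2.symm)

-- The count grows by one exactly after members of `iso`, so it takes every smaller value at some
-- member.
open Classical in
theorem exists_isNth_le (ht : iso t) (hr : r ≤ Nat.count iso t) : ∃ s ≤ t, IsNth iso r s := by
  induction t using Nat.strong_induction_on with
  | _ t ih =>
    rcases hr.eq_or_lt with h | h
    · exact ⟨t, le_rfl, ht, h.symm⟩
    · have hex : ∃ s < t, iso s ∧ r ≤ Nat.count iso s := by
        clear ih ht hr
        induction t with
        | zero => simp at h
        | succ t ih =>
          rw [Nat.count_succ] at h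
          split_ifs at h with hi
          · exact ⟨t, by omega, hi, by omega⟩
          · obtain ⟨s, hs, h'⟩ := ih (by omega)
            exact ⟨s, by omega, h'⟩
      obtain ⟨s, hs, hi, hc⟩ := hex
      obtain ⟨s', hs', h'⟩ := ih s hs hi hc
      exact ⟨s', by omega, h'⟩

-- Successive isolated marks are at least one unit apart, so the last of `c` of them has delay at
-- least `c - 1`.
open Classical in
theorem exists_isolated_of_count_pos (h0 : ∀ t, 0 ≤ d t) (n : ℕ)
    (hn : 0 < Nat.count (Isolated d mark) n) :
    ∃ s < n, Isolated d mark s ∧ (Nat.count (Isolated d mark) n : ℝ) ≤ d s + 1 := by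
  induction n with
  | zero => simp at hn
  | succ n ih =>
    rw [Nat.count_succ] at hn ⊢
    split_ifs at hn ⊢ with hi
    · refine ⟨n, by omega, hi, ?_⟩
      push_cast
      rcases Nat.eq_zero_or_pos (Nat.count (Isolated d mark) n) with h | h
      · rw [h]
        have := h0 n
        push_cast
        linarith
      · obtain ⟨s, hs, his, hc⟩ := ih h
        have : 1 ≤ d n - d s := by
          by_contra! hlt
          exact his.2 ⟨n, hs, hi.1, hlt⟩
        linarith
    · obtain ⟨s, hs, h'⟩ := ih (by omega)
      exact ⟨s, by omega, h'⟩

/-- Whether a mark occurs at a distance in `J ∩ K` is determined by the distances of finitely many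
uniquely determined positions. -/
theorem exists_mark_iff {J K : Set ℝ} {a : ℕ} (hd : Monotone d) (h0 : ∀ t, 0 ≤ d t)
    (hub : ∀ x : ℝ, ∃ t, x ≤ d t) (hJ : ∀ ⦃x y : ℝ⦄, x ≤ y → x ∈ J → y ∈ J)
    (hJa : ∀ ⦃x : ℝ⦄, x ∉ J → x ≤ a) (haJ : (a : ℝ) + 1 ∈ J)
    (hK : ∀ ⦃x y : ℝ⦄, 0 ≤ x → x ≤ y → y ∈ K → x ∈ K) (hKa : ∀ ⦃x : ℝ⦄, 0 ≤ x → x < a + 1 → x ∈ K) :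
    (∃ t, d t ∈ J ∧ d t ∈ K ∧ mark t) ↔
      ∃ r : Fin (a + 2),
        (∃ t, d t ∈ J ∧ d t ∈ K ∧ IsFirstMark mark (Isolated d mark) r t) ∨
        (∃ t, d t ∉ J ∧ IsFirstMark mark (Isolated d mark) r t) ∧
          ¬ ∃ t, d t ∉ J ∧ IsNth (Isolated d mark) r t := by
  classical
  constructor
  · rintro ⟨t, htJ, htK, ht⟩
    have hex : ∃ t, d t ∈ J := ⟨t, htJ⟩
    set T := Nat.find hex with hT
    have hlt : ∀ s, d s ∉ J ↔ s < T := fun s =>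
      ⟨fun h => by
        by_contra! hle
        exact h (hJ (hd hle) (Nat.find_spec hex)), fun h => Nat.find_min hex h⟩
    -- Delays before `J` are at most `a`, which leaves room for at most `a + 1` isolated marks.
    have hr : Nat.count (Isolated d mark) T < a + 2 := by
      rcases Nat.eq_zero_or_pos (Nat.count (Isolated d mark) T) with h | h
      · omega
      · obtain ⟨s, hs, -, hc⟩ := exists_isolated_of_count_pos h0 T h
        have := hJa ((hlt s).2 hs)
        have : (Nat.count (Isolated d mark) T : ℝ) ≤ ((a + 1 : ℕ) : ℝ) := by
          push_cast
          linarith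
        have := Nat.cast_le.1 this
        omega
    refine ⟨⟨_, hr⟩, ?_⟩
    by_cases hcase : ∃ s, s < T ∧ mark s ∧
        Nat.count (Isolated d mark) s = Nat.count (Isolated d mark) T
    · right
      refine ⟨⟨Nat.find hcase, (hlt _).2 (Nat.find_spec hcase).1, (Nat.find_spec hcase).2.1,
        by convert (Nat.find_spec hcase).2.2, ?_⟩, ?_⟩
      · rintro ⟨s, hs, hm, hc⟩
        exact Nat.find_min hcase hs
          ⟨hs.trans (Nat.find_spec hcase).1, hm, by convert hc⟩
      · rintro ⟨s, hsJ, hi, hc⟩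
        have h1 : Nat.count (Isolated d mark) (s + 1) ≤ Nat.count (Isolated d mark) T :=
          Nat.count_monotone _ ((hlt s).1 hsJ)
        have h2 : Nat.count (Isolated d mark) s = Nat.count (Isolated d mark) T := by convert hc
        rw [Nat.count_succ, if_pos hi] at h1
        omega
    -- No earlier mark has the full count, so the first mark from `T` on is the wanted one; it is no
    -- later than `t`, hence in `K`.
    · left
      have hex' : ∃ s, T ≤ s ∧ mark s := ⟨t, Nat.find_min' hex htJ, ht⟩
      obtain ⟨hTs, hm⟩ := Nat.find_spec hex'
      have hst : Nat.find hex' ≤ t := Nat.find_min' hex' ⟨Nat.find_min' hex htJ, ht⟩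
      refine ⟨Nat.find hex', hJ (hd hTs) (Nat.find_spec hex), hK (h0 _) (hd hst) htK, hm, ?_, ?_⟩
      · have : ∀ n, T ≤ n → n ≤ Nat.find hex' →
            Nat.count (Isolated d mark) n = Nat.count (Isolated d mark) T := by
          intro n hn
          induction n, hn using Nat.le_induction with
          | base => intro; rfl
          | succ n hn ih =>
            intro hle
            rw [Nat.count_succ, if_neg, ih (by omega), add_zero]
            exact fun hi => Nat.find_min hex' hle ⟨hn, hi.1⟩
        convert this _ hTs le_rfl
      · rintro ⟨s, hs, hm', hc⟩
        rcases Nat.lt_or_ge s T with h | h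
        · exact hcase ⟨s, h, hm', by convert hc⟩
        · exact Nat.find_min hex' hs ⟨h, hm'⟩
  · rintro ⟨r, ⟨t, htJ, htK, ht⟩ | ⟨⟨t, htJ, ht⟩, hno⟩⟩
    · exact ⟨t, htJ, htK, ht.1⟩
    · obtain ⟨B, hB⟩ := hub (a + 1)
      have hBlt : ∀ s, d s ∉ J → s ≤ B := fun s hs => by
        by_contra! hlt
        exact hs (hJ (hB.trans (hd hlt.le)) haJ)
      -- The last mark before `J`: were it isolated, an isolated mark of index `r` would occur
      -- before `J`.
      let p : ℕ → Prop := fun s => d s ∉ J ∧ mark s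
      have hp : p (Nat.findGreatest p B) := Nat.findGreatest_spec (hBlt t htJ) ⟨htJ, ht.1⟩
      have hle : t ≤ Nat.findGreatest p B := Nat.le_findGreatest (hBlt t htJ) ⟨htJ, ht.1⟩
      have hni : ¬ Isolated d mark (Nat.findGreatest p B) := by
        intro hi
        obtain ⟨s, hs, hs'⟩ := exists_isNth_le (r := r) hi (by
          have h1 : Nat.count (Isolated d mark) t = r := by convert ht.2.1
          have h2 := Nat.count_monotone (Isolated d mark) hle
          convert h1.symm.le.trans h2)
        exact hno ⟨s, fun h => hp.1 (hJ (hd hs) h), hs'⟩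
      have hnext : ∃ s, Nat.findGreatest p B < s ∧ mark s ∧
          d s - d (Nat.findGreatest p B) < 1 := by
        by_contra h
        exact hni ⟨hp.2, h⟩
      obtain ⟨s, hlt, hm, hds⟩ := hnext
      refine ⟨s, ?_, hKa (h0 s) ?_, hm⟩
      · by_contra hsJ
        have : s ≤ Nat.findGreatest p B := Nat.le_findGreatest (hBlt s hsJ) ⟨hsJ, hm⟩
        omega
      · have := hJa hp.1
        linarith

end Marks

theorem run_add {S : Type*} (step : S → ℕ → S) (s₀ : S) (i m n : ℕ) :
    run step s₀ i (m + n) = run step (run step s₀ i m) (i + m) n := by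
  induction n with
  | zero => rfl
  | succ n ih => rw [← add_assoc, run, run, ih, add_assoc]

theorem min_succ_min_succ (c r : ℕ) : min (min c (r + 1) + 1) (r + 1) = min (c + 1) (r + 1) := by
  omega

/-- A counter saturating at `r + 1` still recognizes the value `r`. -/
theorem min_succ_eq_iff {c r : ℕ} : min c (r + 1) = r ↔ c = r := by
  omega

/-- An interval that is not one-sided is the intersection of a lower and an upper bound, between
which there is at least one time unit. -/
theorem Interval.isOneSided_or_exists_inter (I : Interval) :
    I.IsOneSided ∨ ∃ (J K : Interval) (a : ℕ), J.IsOneSided ∧ K.IsOneSided ∧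
      (∀ x : ℝ, 0 ≤ x → (x ∈ I.toSet ↔ x ∈ J.toSet ∧ x ∈ K.toSet)) ∧
      (∀ ⦃x y : ℝ⦄, x ≤ y → x ∈ J.toSet → y ∈ J.toSet) ∧
      (∀ ⦃x : ℝ⦄, x ∉ J.toSet → x ≤ a) ∧ (a : ℝ) + 1 ∈ J.toSet ∧
      (∀ ⦃x y : ℝ⦄, 0 ≤ x → x ≤ y → y ∈ K.toSet → x ∈ K.toSet) ∧
      ∀ ⦃x : ℝ⦄, 0 ≤ x → x < a + 1 → x ∈ K.toSet := by
  have key : ∀ a b : ℕ, a < b → (a : ℝ) + 1 ≤ b := fun a b h => by exact_mod_cast h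
  rcases I with ⟨a, b, h⟩ | ⟨a, b, h⟩ | ⟨a, b, h⟩ | ⟨a, b, h⟩ | a | a
  · refine .inr ⟨.Ici a, .Icc 0 b (by omega), a, trivial, rfl, ?_⟩
    have := key a b h
    simp only [toSet, Set.mem_Icc, Set.mem_Ici, Nat.cast_zero]
    refine ⟨fun x hx => ?_, ?_, ?_, ?_, ?_, ?_⟩ <;> intros <;> grind
  · refine .inr ⟨.Ici a, .Ico 0 b (by omega), a, trivial, rfl, ?_⟩
    have := key a b h
    simp only [toSet, Set.mem_Ico, Set.mem_Ici, Nat.cast_zero]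
    refine ⟨fun x hx => ?_, ?_, ?_, ?_, ?_, ?_⟩ <;> intros <;> grind
  · refine .inr ⟨.Ioi a, .Icc 0 b (by omega), a, trivial, rfl, ?_⟩
    have := key a b h
    simp only [toSet, Set.mem_Icc, Set.mem_Ioc, Set.mem_Ioi, Nat.cast_zero]
    refine ⟨fun x hx => ?_, ?_, ?_, ?_, ?_, ?_⟩ <;> intros <;> grind
  · refine .inr ⟨.Ioi a, .Ico 0 b (by omega), a, trivial, rfl, ?_⟩
    have := key a b h
    simp only [toSet, Set.mem_Ico, Set.mem_Ioo, Set.mem_Ioi, Nat.cast_zero]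
    refine ⟨fun x hx => ?_, ?_, ?_, ?_, ?_, ?_⟩ <;> intros <;> grind
  · exact .inl trivial
  · exact .inl trivial

/-! ### Counting isolated acceptances with a finite machine -/

section Acceptance

variable {Q : Type} (δ : Q → TimedWord (Set AP) → ℕ → Q) (acc : Q → Prop)

/-- The machine `δ`, resumed in state `q` right after position `k`, accepts again within less than
one time unit. -/
def AcceptsSoon (q : Q) (ρ : TimedWord (Set AP)) (k : ℕ) : Prop :=
  ∃ t, (ρ.time (k + 1 + t) : ℝ) - ρ.time k < 1 ∧ acc (run (fun q k => δ q ρ k) q (k + 1) (t + 1))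

/-- The machine `δ`, started in `q₀` at position `i`, is in an accepting state after reading
position `i + t`. -/
def Mark (q₀ : Q) (ρ : TimedWord (Set AP)) (i t : ℕ) : Prop :=
  acc (run (fun q k => δ q ρ k) q₀ i (t + 1))

/-- The time from position `i` to position `i + t`. -/
def TimedWord.delay {Γ : Type*} (ρ : TimedWord Γ) (i t : ℕ) : ℝ :=
  ρ.time (i + t) - ρ.time i

theorem TimedWord.delay_mono {Γ : Type*} (ρ : TimedWord Γ) (i : ℕ) : Monotone (ρ.delay i) :=
  fun _ _ h => sub_le_sub_right (NNReal.coe_le_coe.2 (ρ.time_mono (by omega))) _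

theorem TimedWord.delay_nonneg {Γ : Type*} (ρ : TimedWord Γ) (i t : ℕ) : 0 ≤ ρ.delay i t :=
  sub_nonneg.2 (NNReal.coe_le_coe.2 (ρ.time_mono (by omega)))

theorem TimedWord.exists_le_delay {Γ : Type*} (ρ : TimedWord Γ) (i : ℕ) (x : ℝ) :
    ∃ t, x ≤ ρ.delay i t := by
  obtain ⟨j, hj⟩ := ρ.nonZeno (x.toNNReal + ρ.time i)
  refine ⟨j, ?_⟩
  have h1 : (x.toNNReal : ℝ) + ρ.time i ≤ ρ.time (i + j) := by
    exact_mod_cast hj.trans (ρ.time_mono (by omega))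
  have h2 := Real.le_coe_toNNReal x
  rw [TimedWord.delay]
  linarith

/-- Isolation of a mark depends only on the state reached and on the future, not on the starting
position `i`. -/
theorem isolated_mark_iff (q₀ : Q) (ρ : TimedWord (Set AP)) (i t : ℕ) :
    Isolated (ρ.delay i) (Mark δ acc q₀ ρ i) t ↔
      Mark δ acc q₀ ρ i t ∧
        ¬ AcceptsSoon δ acc (run (fun q k => δ q ρ k) q₀ i (t + 1)) ρ (i + t) := by
  refine and_congr_right fun _ => not_congr ?_
  have h : ∀ s, Mark δ acc q₀ ρ i (t + 1 + s) ↔ acc (run (fun q k => δ q ρ k)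
      (run (fun q k => δ q ρ k) q₀ i (t + 1)) (i + t + 1) (s + 1)) := fun s => by
    rw [Mark, add_assoc (t + 1) s 1, run_add, ← add_assoc i t 1]
  have h' : ∀ s, ρ.delay i (t + 1 + s) - ρ.delay i t =
      (ρ.time (i + t + 1 + s) : ℝ) - ρ.time (i + t) := fun s => by
    rw [TimedWord.delay, TimedWord.delay, sub_sub_sub_cancel_right, ← add_assoc, ← add_assoc]
  constructor
  · rintro ⟨s, hs, hm, hd⟩
    obtain ⟨s, rfl⟩ := Nat.exists_eq_add_of_le (Nat.succ_le_of_lt hs)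
    exact ⟨s, (h' s) ▸ hd, (h s).1 hm⟩
  · rintro ⟨s, hd, hm⟩
    exact ⟨t + 1 + s, by omega, (h s).2 hm, (h' s).symm ▸ hd⟩

variable {δ}

/-- The machine `δ` together with the number of isolated acceptances, counted up to `r + 1`, and
the information whether `δ` accepted while that number was `r`. -/
noncomputable def countingStep (δ : Q → TimedWord (Set AP) → ℕ → Q) (acc : Q → Prop) (r : ℕ)
    (s : Q × Fin (r + 2) × Prop) (ρ : TimedWord (Set AP)) (k : ℕ) : Q × Fin (r + 2) × Prop :=
  open Classical in
  (δ s.1 ρ k,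
    if acc (δ s.1 ρ k) ∧ ¬ AcceptsSoon δ acc (δ s.1 ρ k) ρ k then
      ⟨min (s.2.1 + 1) (r + 1), by omega⟩ else s.2.1,
    s.2.2 ∨ acc (δ s.1 ρ k) ∧ (s.2.1 : ℕ) = r)

open Classical in
theorem run_countingStep (q₀ : Q) (r : ℕ) (ρ : TimedWord (Set AP)) (i t : ℕ) :
    let s := run (fun s k => countingStep δ acc r s ρ k) (q₀, 0, False) i t
    s.1 = run (fun q k => δ q ρ k) q₀ i t ∧
      (s.2.1 : ℕ) = min (Nat.count (Isolated (ρ.delay i) (Mark δ acc q₀ ρ i)) t) (r + 1) ∧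
      (s.2.2 ↔ ∃ u, u < t ∧ Mark δ acc q₀ ρ i u ∧
        Nat.count (Isolated (ρ.delay i) (Mark δ acc q₀ ρ i)) u = r) := by
  induction t with
  | zero => simp [run]
  | succ t ih =>
    obtain ⟨h1, h2, h3⟩ := ih
    have hrun : δ (run (fun s k => countingStep δ acc r s ρ k) (q₀, 0, False) i t).1 ρ (i + t) =
        run (fun q k => δ q ρ k) q₀ i (t + 1) := by
      rw [h1, run]
    refine ⟨hrun, ?_, ?_⟩
    · have hiso := isolated_mark_iff δ acc q₀ ρ i t
      rw [Mark] at hiso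
      rw [run, countingStep, hrun, Nat.count_succ]
      simp only [← hiso]
      split_ifs
      · simp only [h2, min_succ_min_succ]
      · simpa using h2
    · rw [run, countingStep, hrun]
      simp only [h2, h3]
      rw [min_succ_eq_iff]
      constructor
      · rintro (⟨u, hu, h⟩ | h)
        · exact ⟨u, by omega, h⟩
        · exact ⟨t, by omega, h⟩
      · rintro ⟨u, hu, h⟩
        rcases Nat.lt_succ_iff_lt_or_eq.1 hu with hu | rfl
        · exact .inl ⟨u, hu, h⟩
        · exact .inr h

/-! ### Definability of acceptance within an interval -/

variable [Finite Q]

theorem definable_acceptsSoon (hδ : ∀ q, DefinableFun (δ q)) (q : Q) :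
    Definable (AcceptsSoon δ acc q) := by
  -- A modality at `k` also reads position `k`; the extra state `none` skips it without accepting.
  let step : Option Q → TimedWord (Set AP) → ℕ → Option Q := fun s ρ k =>
    s.elim (some q) fun p => some (δ p ρ k)
  let out : Option Q → TimedWord (Set AP) → ℕ → Prop := fun s ρ k =>
    s.elim False fun p => acc (δ p ρ k)
  have hstep : ∀ s, DefinableFun (step s)
    | none => DefinableFun.const (some q)
    | some p => (hδ p).comp some
  have hout : ∀ s, Definable (out s)
    | none => Definable.const False
    | some p => (hδ p).definable fun p' => Definable.const (acc p')
  refine (Definable.machine hstep hout none (I := .Ico 0 1 one_pos) rfl).congr fun ρ k => ?_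
  have hrun : ∀ t, run (fun s k => step s ρ k) none k (t + 1) =
      some (run (fun q k => δ q ρ k) q (k + 1) t) := by
    intro t
    induction t with
    | zero => rfl
    | succ t ih =>
      rw [run, ih, run, add_assoc k 1 t, add_comm 1 t]
      rfl
  constructor
  · rintro ⟨t, hI, ho⟩
    cases t with
    | zero => exact ho.elim
    | succ t =>
      rw [hrun] at ho
      have hk : k + (t + 1) = k + 1 + t := by omega
      rw [hk] at hI ho
      refine ⟨t, ?_, ho⟩
      simpa using hI.2
  · rintro ⟨t, hd, ha⟩
    refine ⟨t + 1, ?_, ?_⟩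
    · have := ρ.delay_nonneg k (t + 1)
      refine ⟨by rw [Nat.cast_zero]; exact this, ?_⟩
      rw [add_assoc k 1 t, add_comm 1 t] at hd
      simpa using hd
    · rw [hrun, ← add_assoc, add_right_comm]
      exact ha

theorem definableFun_countingStep (hδ : ∀ q, DefinableFun (δ q)) (r : ℕ)
    (s : Q × Fin (r + 2) × Prop) : DefinableFun (countingStep δ acc r s) := by
  classical
  refine (hδ s.1).bind (g := fun q' ρ k => (q',
    if acc q' ∧ ¬ AcceptsSoon δ acc q' ρ k then
      (⟨min (s.2.1 + 1) (r + 1), by omega⟩ : Fin (r + 2)) else s.2.1,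
    s.2.2 ∨ acc q' ∧ (s.2.1 : ℕ) = r)) fun q' => ?_
  exact (definable_acceptsSoon acc hδ q').definableFun.comp fun p => (q',
    if acc q' ∧ ¬ p then (⟨min (s.2.1 + 1) (r + 1), by omega⟩ : Fin (r + 2)) else s.2.1,
    s.2.2 ∨ acc q' ∧ (s.2.1 : ℕ) = r)

theorem definable_isFirstMark (hδ : ∀ q, DefinableFun (δ q)) (q₀ : Q) (r : ℕ) {I : Interval}
    (hI : I.IsOneSided) :
    Definable fun ρ i => ∃ t, ρ.delay i t ∈ I.toSet ∧
      IsFirstMark (Mark δ acc q₀ ρ i) (Isolated (ρ.delay i) (Mark δ acc q₀ ρ i)) r t := by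
  refine (Definable.machine (definableFun_countingStep acc hδ r)
    (out := fun s ρ k => acc (δ s.1 ρ k) ∧ (s.2.1 : ℕ) = r ∧ ¬ s.2.2)
    (fun s => (hδ s.1).definable fun q' => Definable.const (acc q' ∧ (s.2.1 : ℕ) = r ∧ ¬ s.2.2))
    (q₀, 0, False) hI).congr fun ρ i => exists_congr fun t => and_congr_right fun _ => ?_
  obtain ⟨h1, h2, h3⟩ := run_countingStep (δ := δ) acc q₀ r ρ i t
  rw [h1, h2, h3]
  exact and_congr Iff.rfl (and_congr min_succ_eq_iff Iff.rfl)

theorem definable_isNth (hδ : ∀ q, DefinableFun (δ q)) (q₀ : Q) (r : ℕ) {I : Interval}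
    (hI : I.IsOneSided) :
    Definable fun ρ i => ∃ t, ρ.delay i t ∈ I.toSet ∧
      IsNth (Isolated (ρ.delay i) (Mark δ acc q₀ ρ i)) r t := by
  refine (Definable.machine (definableFun_countingStep acc hδ r)
    (out := fun s ρ k =>
      (acc (δ s.1 ρ k) ∧ ¬ AcceptsSoon δ acc (δ s.1 ρ k) ρ k) ∧ (s.2.1 : ℕ) = r)
    (fun s => (hδ s.1).definable
      (P := fun q' ρ k => (acc q' ∧ ¬ AcceptsSoon δ acc q' ρ k) ∧ (s.2.1 : ℕ) = r) fun q' =>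
        ((Definable.const (acc q')).and (definable_acceptsSoon acc hδ q').not).and
          (Definable.const ((s.2.1 : ℕ) = r)))
    (q₀, 0, False) hI).congr fun ρ i => exists_congr fun t => and_congr_right fun _ => ?_
  obtain ⟨h1, h2, -⟩ := run_countingStep (δ := δ) acc q₀ r ρ i t
  rw [h1, h2]
  exact and_congr (isolated_mark_iff δ acc q₀ ρ i t).symm min_succ_eq_iff

/-- For a uniquely determined position, being outside an interval is definable. -/
theorem Definable.exists_not_mem {F : TimedWord (Set AP) → ℕ → ℕ → Prop}
    (hF : ∀ ⦃ρ i t t'⦄, F ρ i t → F ρ i t' → t = t')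
    (h : ∀ I : Interval, I.IsOneSided → Definable fun ρ i => ∃ t, ρ.delay i t ∈ I.toSet ∧ F ρ i t)
    {J : Interval} (hJ : J.IsOneSided) :
    Definable fun ρ i => ∃ t, ρ.delay i t ∉ J.toSet ∧ F ρ i t := by
  -- The constraint `[0, ∞)` is vacuous and only asserts that the position exists.
  refine ((h (.Ici 0) trivial).and (h J hJ).not).congr fun ρ i => ?_
  constructor
  · rintro ⟨⟨t, -, ht⟩, hno⟩
    exact ⟨t, fun hm => hno ⟨t, hm, ht⟩, ht⟩
  · rintro ⟨t, hm, ht⟩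
    refine ⟨⟨t, ?_, ht⟩, ?_⟩
    · simpa [Interval.toSet] using ρ.delay_nonneg i t
    · rintro ⟨t', hm', ht'⟩
      exact hm (hF ht ht' ▸ hm')

theorem definable_exists_mark (hδ : ∀ q, DefinableFun (δ q)) (q₀ : Q) (I : Interval) :
    Definable fun ρ i => ∃ t, ρ.delay i t ∈ I.toSet ∧ Mark δ acc q₀ ρ i t := by
  rcases I.isOneSided_or_exists_inter with hI | ⟨J, K, a, hJ, hK, hI, hJ1, hJ2, hJ3, hK1, hK2⟩
  · exact Definable.machine hδ (out := fun q ρ k => acc (δ q ρ k))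
      (fun q => (hδ q).definable fun q' => Definable.const (acc q')) q₀ hI
  have hfirst := definable_isFirstMark acc hδ q₀
  have hnth := definable_isNth acc hδ q₀
  refine (Definable.exists_finite fun r : Fin (a + 2) =>
    ((hfirst r hJ).and (hfirst r hK)).or
      ((Definable.exists_not_mem
          (F := fun ρ i =>
            IsFirstMark (Mark δ acc q₀ ρ i) (Isolated (ρ.delay i) (Mark δ acc q₀ ρ i)) r)
          (fun _ _ _ _ => IsFirstMark.unique) (fun _ => hfirst r) hJ).and
        (Definable.exists_not_mem
          (F := fun ρ i => IsNth (Isolated (ρ.delay i) (Mark δ acc q₀ ρ i)) r)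
          (fun _ _ _ _ => IsNth.unique) (fun _ => hnth r) hJ).not)).congr
    fun ρ i => ?_
  have hiff := exists_mark_iff (mark := Mark δ acc q₀ ρ i) (ρ.delay_mono i) (ρ.delay_nonneg i)
    (ρ.exists_le_delay i) hJ1 hJ2 hJ3 hK1 hK2
  simp only [hI _ (ρ.delay_nonneg i _), and_assoc]
  rw [hiff]
  refine exists_congr fun r => or_congr ?_ Iff.rfl
  -- Uniqueness of the first mark merges the separate tests for `J` and `K` into one for the same
  -- position.
  constructor
  · rintro ⟨⟨t, h, ht⟩, t', h', ht'⟩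
    obtain rfl := ht.unique ht'
    exact ⟨t, h, h', ht⟩
  · rintro ⟨t, h, h', ht⟩
    exact ⟨⟨t, h, ht⟩, t, h', ht⟩

end Acceptance

theorem Formula.definable_sat (φ : Formula AP) : Definable φ.Sat := by
  induction φ with
  | top => exact (Definable.const True).congr fun _ _ => Iff.rfl
  | atom p => exact ⟨.atom p, trivial, fun _ _ => Iff.rfl⟩
  | and φ ψ hφ hψ => exact hφ.and hψ
  | neg φ hφ => exact hφ.not
  | modality n A I args ih =>
    have := A.finite_loc
    -- The subset step depends only on the finite vector of truth values of the arguments, definable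
    -- by induction.
    have hpost : ∀ q : Set A.Loc,
        DefinableFun fun ρ k => A.post q {a | (args a).Sat ρ k} := fun q =>
      DefinableFun.comp (X := Fin n → Prop)
        (f := fun ρ k a => (args a).Sat ρ k)
        (fun f => (Definable.forall_finite fun a => (ih a).definableFun (f a)).congr
          fun ρ k => by rw [funext_iff]) fun f => A.post q {a | f a}
    refine (definable_exists_mark (fun q => ∃ s ∈ A.final, s ∈ q) hpost {A.init} I).congr
      fun ρ i => ?_
    rw [sat_modality_iff]
    exact Iff.rfl

end EMITL

theorem theorem3 {AP : Type*} [Finite AP] :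
    {L : EMITL.TimedLanguage (Set AP) |
        ∃ φ : EMITL.Formula AP, φ.IsOneSided ∧ φ.language = L} =
      {L : EMITL.TimedLanguage (Set AP) |
        ∃ φ : EMITL.Formula AP, φ.language = L} := by
  ext L
  constructor
  · rintro ⟨φ, -, h⟩
    exact ⟨φ, h⟩
  · rintro ⟨φ, rfl⟩
    obtain ⟨ψ, hψ, h⟩ := φ.definable_sat
    exact ⟨ψ, hψ, Set.ext fun ρ => h ρ 0⟩
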